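/- Let $\mathbb D=\{|z|<1\}$, $\mathbb S=\partial\mathbb D$, and let $(\mu_t)_{t\ge 0}$ be the hydrodynamic limit of the circular Dyson Brownian motions started from the single source $\mu_0=\delta_1$: the probability measures on $\mathbb S$ with $\mu_0=\delta_1$ whose circular Stieltjes transform $M_t(z)=\int_{\mathbb S}\frac{x+z}{x-z}\,\mu_t(dx)$ satisfies $\partial_t M_t(z)+2zM_t(z)\,\partial_z M_t(z)=0$ for $t\ge 0$, $z\in\mathbb D$. In particular $M_0(z)=\frac{1+z}{1-z}$. Let $g_t(z)$ be the solution of the Loewner equation $\frac{d}{dt}g_t(z)=g_t(z)M_t(g_t(z))$, $g_0(z)=z\in\mathbb D$, and let $\mathbb D_t$ be the set of those $z\in\mathbb D$ for which the solution exists in $\mathbb D$ until time $t$. Put $h_t(z)=g_t(z)e^{-2tM_t(g_t(z))}$ for $z\in\mathbb D_t$, $\widetilde{\mathbb D}_t=h_t(\mathbb D_t)$, and $\Omega_t(z)=z\exp\!\big(2t\,\tfrac{1+z}{1-z}\big)$ for $z\neq 1$. For $0<r<1$ let $F_t(r)=\frac{t(1-r^2)}{r\log r}+\frac{1+r^2}{2r}$.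 Let $r_t^{\min}\in(0,1]$ be the unique solution of $t=-\frac{1-r}{2(1+r)}\log r$ (for $t>0$ this is the unique $r\in(0,1)$ with $F_t(r)=1$, and $r_0^{\min}=1$). For $t>1$ let $r_t^{\max}\in(0,1)$ be the unique solution of $t=-\frac{1+r}{2(1-r)}\log r$, that is, of $F_t(r)=-1$. For $t\le 1$ let $\theta_t^{\mathrm c}=\arccos(1-2t)$. Define $$\widetilde\gamma_t=\begin{cases}\{re^{\pm i\theta}:\theta=\arccos F_t(r),\ r\in[r_t^{\min},1)\}\cup\{e^{\pm i\theta_t^{\mathrm c}}\}, & 0\le t\le 1,\\ \{re^{\pm i\theta}:\theta=\arccos F_t(r),\ r\in[r_t^{\min},r_t^{\max}]\}, & t>1.\end{cases}$$ Then for every $t\ge 0$ the set $\widetilde{\mathbb D}_t$ is the connected component of $\mathbb D\setminus\widetilde\gamma_t$ that contains $0$. Moreover, $\widetilde{\mathbb D}_t$ is an open neighbourhood of $0$ which $\Omega_t$ maps conformally (holomorphically and bijectively) onto $\mathbb D$, and it is the only open set $U\subset\mathbb C\setminus\{1\}$ containing $0$ that $\Omega_t$ maps conformally onto $\mathbb D$.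 -/

import Mathlib

open MeasureTheory

namespace RadialSLE

noncomputable section

/-- The unit circle carries its Borel σ-algebra. -/
instance circleMeasurableSpace : MeasurableSpace Circle := borel Circle

instance circleBorelSpace : BorelSpace Circle := ⟨rfl⟩

/-- Circular Stieltjes transform of a measure on the unit circle:
`z ↦ ∫ (x + z) / (x - z) μ(dx)`. -/
def stieltjes (μ : Measure Circle) (z : ℂ) : ℂ :=
  ∫ x : Circle, ((x : ℂ) + z) / ((x : ℂ) - z) ∂μ

/-- `(μ_t)_{t ≥ 0}` is the hydrodynamic limit of the circular Dyson Brownian motions started from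
the single source `1`: the family of probability measures on the unit circle with `μ_0 = δ_1` whose
circular Stieltjes transform `M_t(z)` solves the inviscid complex Burgers equation
`∂_t M_t(z) + 2 z M_t(z) ∂_z M_t(z) = 0` for `t ≥ 0` (one-sided derivative at `t = 0`).
The equation is only asked for on the open unit disk, which already determines the family. Values
`μ t` at negative times are irrelevant. -/
structure IsHydrodynamicLimit (μ : ℝ → Measure Circle) : Prop where
  isProbabilityMeasure : ∀ t : ℝ, 0 ≤ t → IsProbabilityMeasure (μ t)
  initial : μ 0 = Measure.dirac 1
  burgers : ∀ t : ℝ, 0 ≤ t → ∀ z : ℂ, z ∈ Metric.ball (0 : ℂ) 1 →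
    HasDerivWithinAt (fun s : ℝ => stieltjes (μ s) z)
      (-(2 * z * stieltjes (μ t) z * deriv (stieltjes (μ t)) z)) (Set.Ici 0) t

/-- `w : ℝ → ℂ` solves, on the time interval `[0, t]` and within the open unit disk, the
measure-driven radial Loewner equation `dw/ds = w M_s(w)`, `w(0) = z`. -/
def IsLoewnerSolution (μ : ℝ → Measure Circle) (t : ℝ) (z : ℂ) (w : ℝ → ℂ) : Prop :=
  w 0 = z ∧ ∀ s ∈ Set.Icc (0 : ℝ) t, w s ∈ Metric.ball (0 : ℂ) 1 ∧
    HasDerivWithinAt w (w s * stieltjes (μ s) (w s)) (Set.Icc 0 t) s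

/-- The domain `𝔻_t` of the Loewner chain: the points `z` of the unit disk for which the solution
of the Loewner equation exists until time `t`. -/
def loewnerDomain (μ : ℝ → Measure Circle) (t : ℝ) : Set ℂ :=
  {z | z ∈ Metric.ball (0 : ℂ) 1 ∧ ∃ w : ℝ → ℂ, IsLoewnerSolution μ t z w}

open Classical in
/-- The Loewner map `g_t`: the value at time `t` of the solution started from `z ∈ 𝔻_t`
(junk value `0` outside `𝔻_t`). -/
def loewnerMap (μ : ℝ → Measure Circle) (t : ℝ) (z : ℂ) : ℂ :=
  if h : ∃ w : ℝ → ℂ, IsLoewnerSolution μ t z w then h.choose t else 0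

/-- `h_t(z) = g_t(z) exp (-2 t M_t(g_t(z)))`. -/
def hMap (μ : ℝ → Measure Circle) (t : ℝ) (z : ℂ) : ℂ :=
  loewnerMap μ t z * Complex.exp (-(2 * (t : ℂ) * stieltjes (μ t) (loewnerMap μ t z)))

/-- The domain `h_t(𝔻_t)`. -/
def tildeDomain (μ : ℝ → Measure Circle) (t : ℝ) : Set ℂ :=
  hMap μ t '' loewnerDomain μ t

/-- `Ω_t(z) = z exp (2 t M_0(z))`, where `M_0(z) = (1 + z) / (1 - z)` is the circular Stieltjes
transform of `δ_1`. -/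
def Omega (t : ℝ) (z : ℂ) : ℂ :=
  z * Complex.exp (2 * (t : ℂ) * ((1 + z) / (1 - z)))

/-- `F_t(r) = t (1 - r²) / (r log r) + (1 + r²) / (2 r)`, used for `0 < r < 1`. -/
def F (t r : ℝ) : ℝ :=
  t * (1 - r ^ 2) / (r * Real.log r) + (1 + r ^ 2) / (2 * r)

/-- `r_t^min`: the unique solution `r ∈ (0, 1]` of `t = -(1 - r) / (2 (1 + r)) log r`. For `t > 0`
it is the unique solution in `(0, 1)` of `F_t(r) = 1`; for `t = 0` it is `1`. The infimum of the
one-point solution set picks out the solution. -/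
def rMin (t : ℝ) : ℝ :=
  sInf {r : ℝ | 0 < r ∧ r ≤ 1 ∧ t = -((1 - r) / (2 * (1 + r)) * Real.log r)}

/-- `r_t^max`, used for `t > 1`: the unique solution `r ∈ (0, 1)` of
`t = -(1 + r) / (2 (1 - r)) log r`, equivalently of `F_t(r) = -1`. -/
def rMax (t : ℝ) : ℝ :=
  sInf {r : ℝ | 0 < r ∧ r < 1 ∧ t = -((1 + r) / (2 * (1 - r)) * Real.log r)}

/-- The critical angle `θ_t^c = arccos (1 - 2 t)`, used for `t ≤ 1`. -/
def thetaC (t : ℝ) : ℝ := Real.arccos (1 - 2 * t)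

/-- The points `r e^{iθ}` with `r ∈ I` and `θ = arccos F_t(r)`, with both signs of the angle. -/
def polarCurve (t : ℝ) (I : Set ℝ) : Set ℂ :=
  {z | ∃ r ∈ I, ∃ θ : ℝ, |θ| = Real.arccos (F t r) ∧
    z = (r : ℂ) * Complex.exp ((θ : ℂ) * Complex.I)}

open Classical in
/-- The curve `γ̃_t`. -/
def tildeGamma (t : ℝ) : Set ℂ :=
  if t ≤ 1 then
    polarCurve t (Set.Ico (rMin t) 1) ∪
      {Complex.exp ((thetaC t : ℂ) * Complex.I), Complex.exp (-((thetaC t : ℂ) * Complex.I))}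
  else polarCurve t (Set.Icc (rMin t) (rMax t))

/-- `f` maps the open set `U` conformally onto `V`: it is holomorphic on `U` and restricts to a
bijection from `U` onto `V`. -/
def MapsConformallyOnto (f : ℂ → ℂ) (U V : Set ℂ) : Prop :=
  IsOpen U ∧ DifferentiableOn ℂ f U ∧ Set.BijOn f U V

end

end RadialSLE

namespace RadialSLE

noncomputable section

/-! The Burgers equation is solved by characteristics: `M_s` is constant, equal to `c`, along `z₀
exp(2sc)`. Forward from `z` with `c = M_0(z)`, this gives `M_t(Ω_t(z)) = M_0(z)` whenever `z` and
`Ω_t(z)` lie in the disk (`stieltjes_Omega`). Backward from any `w` in the disk, `Re M_t ≥ 0` keeps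
the path inside (`stieltjes_zero_backward`). So `w ↦ w exp(-2t M_t(w))` is a bijection from the disk
onto `subunitDomain t`, the set where `|z| < 1` and `|Ω_t(z)| < 1`, with inverse `Ω_t`. Since `g_t`
is onto the disk (`image_loewnerMap`), `h_t(𝔻_t)` is this same set.

In polar coordinates `|Ω_t| = 1` reads `cos θ = F_t(r)`, so `γ̃_t` is this level set inside the disk
(`mem_tildeGamma_iff`). Off it, the disk splits into the open sets `|Ω_t| < 1` and `|Ω_t| > 1`, and
the first is connected as a continuous image of the disk. Uniqueness is a topological argument
resting on the open mapping theorem (`MapsConformallyOnto.eq`). -/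

/-- The derivative of the circular Stieltjes transform, as an integral. -/
def stieltjesDeriv (ν : Measure Circle) (z : ℂ) : ℂ :=
  ∫ x : Circle, 2 * (x : ℂ) / ((x : ℂ) - z) ^ 2 ∂ν

/-! ### Bounds on the Stieltjes transform, uniform in the measure -/

lemma one_sub_le_norm_circle_sub (x : Circle) {z : ℂ} {ρ : ℝ} (hz : ‖z‖ ≤ ρ) :
    1 - ρ ≤ ‖(x : ℂ) - z‖ := by
  have := norm_sub_norm_le (x : ℂ) z
  rw [Circle.norm_coe] at this
  linarith

lemma circle_sub_ne_zero (x : Circle) {z : ℂ} (hz : ‖z‖ < 1) : (x : ℂ) - z ≠ 0 := by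
  rw [← norm_pos_iff]
  have := one_sub_le_norm_circle_sub x le_rfl (z := z)
  linarith

lemma integrable_circle_of_continuous {ν : Measure Circle} [IsFiniteMeasure ν] {f : Circle → ℂ}
    (hf : Continuous f) : Integrable f ν :=
  hf.integrable_of_hasCompactSupport (HasCompactSupport.of_compactSpace f)

section

variable {ν : Measure Circle} [IsProbabilityMeasure ν]

lemma integrable_stieltjes_kernel {z : ℂ} (hz : ‖z‖ < 1) :
    Integrable (fun x : Circle => ((x : ℂ) + z) / ((x : ℂ) - z)) ν :=
  integrable_circle_of_continuous <| by
    refine Continuous.div₀ (by fun_prop) (by fun_prop) fun x => circle_sub_ne_zero x hz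

lemma integrable_stieltjesDeriv_kernel {z : ℂ} (hz : ‖z‖ < 1) :
    Integrable (fun x : Circle => 2 * (x : ℂ) / ((x : ℂ) - z) ^ 2) ν :=
  integrable_circle_of_continuous <| by
    refine Continuous.div₀ (by fun_prop) (by fun_prop)
      fun x => pow_ne_zero 2 (circle_sub_ne_zero x hz)

lemma norm_integral_le_of_forall_le {f : Circle → ℂ} {C : ℝ} (h : ∀ x, ‖f x‖ ≤ C) :
    ‖∫ x, f x ∂ν‖ ≤ C := by
  simpa using norm_integral_le_of_norm_le_const (μ := ν) (Filter.Eventually.of_forall h)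

/-- The kernel's Taylor remainder is an explicit multiple of `(z' - z)²`. The constant does not
depend on the measure, hence not on time; this replaces joint regularity in `(t, z)`. -/
lemma norm_stieltjes_sub_sub_le {z z' : ℂ} {ρ : ℝ} (hρ : ρ < 1) (hz : ‖z‖ ≤ ρ) (hz' : ‖z'‖ ≤ ρ) :
    ‖stieltjes ν z' - stieltjes ν z - stieltjesDeriv ν z * (z' - z)‖ ≤
      2 / (1 - ρ) ^ 3 * ‖z' - z‖ ^ 2 := by
  have h1 := integrable_stieltjes_kernel (ν := ν) (hz.trans_lt hρ)
  have h2 := integrable_stieltjes_kernel (ν := ν) (hz'.trans_lt hρ)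
  have h3 := integrable_stieltjesDeriv_kernel (ν := ν) (hz.trans_lt hρ)
  have h21 : Integrable (fun x : Circle =>
      ((x : ℂ) + z') / ((x : ℂ) - z') - ((x : ℂ) + z) / ((x : ℂ) - z)) ν := h2.sub h1
  unfold stieltjes stieltjesDeriv
  rw [← integral_mul_const, ← integral_sub h2 h1, ← integral_sub h21 (h3.mul_const _)]
  refine norm_integral_le_of_forall_le fun x => ?_
  have e1 := circle_sub_ne_zero x (hz.trans_lt hρ)
  have e2 := circle_sub_ne_zero x (hz'.trans_lt hρ)
  have key : ((x : ℂ) + z') / ((x : ℂ) - z') - ((x : ℂ) + z) / ((x : ℂ) - z) -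
      2 * (x : ℂ) / ((x : ℂ) - z) ^ 2 * (z' - z) =
      2 * x / (((x : ℂ) - z') * ((x : ℂ) - z) ^ 2) * (z' - z) ^ 2 := by
    field_simp
    ring
  rw [key, norm_mul, norm_pow, norm_div, norm_mul, norm_mul, norm_pow, Circle.norm_coe]
  have b1 := one_sub_le_norm_circle_sub x hz
  have b2 := one_sub_le_norm_circle_sub x hz'
  have hpos : 0 < 1 - ρ := by linarith
  gcongr
  · simp
  · calc (1 - ρ) ^ 3 = (1 - ρ) * (1 - ρ) ^ 2 := by ring
      _ ≤ _ := by gcongr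

lemma norm_stieltjesDeriv_le {z : ℂ} {ρ : ℝ} (hρ : ρ < 1) (hz : ‖z‖ ≤ ρ) :
    ‖stieltjesDeriv ν z‖ ≤ 2 / (1 - ρ) ^ 2 := by
  refine norm_integral_le_of_forall_le fun x => ?_
  rw [norm_div, norm_mul, norm_pow, Circle.norm_coe]
  have b1 := one_sub_le_norm_circle_sub x hz
  have hpos : 0 < 1 - ρ := by linarith
  gcongr
  simp

lemma norm_stieltjes_le {z : ℂ} {ρ : ℝ} (hρ : ρ < 1) (hz : ‖z‖ ≤ ρ) :
    ‖stieltjes ν z‖ ≤ 2 / (1 - ρ) := by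
  refine norm_integral_le_of_forall_le fun x => ?_
  rw [norm_div]
  have b1 := one_sub_le_norm_circle_sub x hz
  have hpos : 0 < 1 - ρ := by linarith
  gcongr
  refine (norm_add_le _ _).trans ?_
  rw [Circle.norm_coe]
  linarith

lemma norm_stieltjes_sub_le {z z' : ℂ} {ρ : ℝ} (hρ : ρ < 1) (hz : ‖z‖ ≤ ρ) (hz' : ‖z'‖ ≤ ρ) :
    ‖stieltjes ν z' - stieltjes ν z‖ ≤ 2 / (1 - ρ) ^ 2 * ‖z' - z‖ := by
  have h1 := integrable_stieltjes_kernel (ν := ν) (hz.trans_lt hρ)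
  have h2 := integrable_stieltjes_kernel (ν := ν) (hz'.trans_lt hρ)
  unfold stieltjes
  rw [← integral_sub h2 h1]
  refine norm_integral_le_of_forall_le fun x => ?_
  have e1 := circle_sub_ne_zero x (hz.trans_lt hρ)
  have e2 := circle_sub_ne_zero x (hz'.trans_lt hρ)
  have key : ((x : ℂ) + z') / ((x : ℂ) - z') - ((x : ℂ) + z) / ((x : ℂ) - z) =
      2 * x / (((x : ℂ) - z') * ((x : ℂ) - z)) * (z' - z) := by
    field_simp
    ring
  rw [key, norm_mul, norm_div, norm_mul, norm_mul, Circle.norm_coe]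
  have b1 := one_sub_le_norm_circle_sub x hz
  have b2 := one_sub_le_norm_circle_sub x hz'
  have hpos : 0 < 1 - ρ := by linarith
  gcongr
  · simp
  · rw [pow_two]
    gcongr

/-- The real part of the kernel is the Poisson kernel. -/
lemma stieltjes_re_nonneg {z : ℂ} (hz : ‖z‖ < 1) : 0 ≤ (stieltjes ν z).re := by
  have h := Complex.reCLM.integral_comp_comm (integrable_stieltjes_kernel (ν := ν) hz)
  simp only [Complex.reCLM_apply] at h
  rw [stieltjes, ← h]
  refine integral_nonneg fun x => ?_
  simp only [Pi.zero_apply]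
  have hx : (x : ℂ).re ^ 2 + (x : ℂ).im ^ 2 = 1 := by
    have := Circle.normSq_coe x
    rw [Complex.normSq_apply] at this
    linarith
  have hz2 : z.re ^ 2 + z.im ^ 2 ≤ 1 := by
    have h0 : ‖z‖ ^ 2 ≤ 1 := by nlinarith [norm_nonneg z]
    rw [Complex.sq_norm, Complex.normSq_apply] at h0
    linarith
  rw [Complex.div_re, ← add_div]
  refine div_nonneg ?_ (Complex.normSq_nonneg _)
  simp only [Complex.add_re, Complex.sub_re, Complex.add_im, Complex.sub_im]
  nlinarith

lemma hasDerivAt_stieltjes {z : ℂ} (hz : ‖z‖ < 1) :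
    HasDerivAt (stieltjes ν) (stieltjesDeriv ν z) z := by
  obtain ⟨ρ, hzρ, hρ⟩ := exists_between hz
  rw [hasDerivAt_iff_isLittleO]
  have hb : (fun z' => stieltjes ν z' - stieltjes ν z - (z' - z) • stieltjesDeriv ν z)
      =O[nhds z] fun z' => ‖z' - z‖ ^ 2 := by
    refine Asymptotics.IsBigO.of_bound (2 / (1 - ρ) ^ 3) ?_
    filter_upwards [continuous_norm.continuousAt.eventually (gt_mem_nhds hzρ)] with z' hz'
    rw [smul_eq_mul, mul_comm (z' - z), norm_pow, norm_norm]
    exact norm_stieltjes_sub_sub_le hρ hzρ.le (le_of_lt hz')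
  refine hb.trans_isLittleO ?_
  have : Filter.Tendsto (fun z' : ℂ => z' - z) (nhds z) (nhds 0) := by
    simpa using (continuous_id.sub continuous_const).tendsto z (f := fun z' : ℂ => z' - z)
  exact (Asymptotics.isLittleO_norm_pow_id one_lt_two).comp_tendsto this

end

/-! ### Characteristics of the Burgers equation -/

/-- Solutions of a scalar linear ODE with bounded coefficient that vanish at one time vanish
identically. -/
lemma eq_zero_of_hasDerivWithinAt_mul {t K : ℝ} {e a : ℝ → ℂ}
    (he : ∀ s ∈ Set.Icc 0 t, HasDerivWithinAt e (a s * e s) (Set.Icc 0 t) s)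
    (ha : ∀ s ∈ Set.Icc 0 t, ‖a s‖ ≤ K) {s₀ : ℝ} (hs₀ : s₀ ∈ Set.Icc 0 t) (h0 : e s₀ = 0) :
    ∀ s ∈ Set.Icc 0 t, e s = 0 := by
  have hc : ContinuousOn e (Set.Icc 0 t) := fun s hs => (he s hs).continuousWithinAt
  have hlip : ∀ s ∈ Set.Icc 0 t, LipschitzOnWith K.toNNReal (fun y : ℂ => a s * y) Set.univ := by
    intro s hs
    refine LipschitzOnWith.of_dist_le_mul fun x _ y _ => ?_
    rw [dist_eq_norm, dist_eq_norm, ← mul_sub, norm_mul]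
    gcongr
    exact (ha s hs).trans (Real.le_coe_toNNReal K)
  intro s hs
  rcases le_total s₀ s with h | h
  · refine ODE_solution_unique_of_mem_Icc_right (v := fun s y => a s * y) (s := fun _ => Set.univ)
      (f := e) (g := fun _ => 0) (a := s₀) (b := t) (K := K.toNNReal)
      (fun r hr => hlip r ⟨hs₀.1.trans hr.1, hr.2.le⟩)
      (hc.mono (Set.Icc_subset_Icc_left hs₀.1)) (fun r hr => ?_) (fun _ _ => Set.mem_univ _)
      continuousOn_const (fun r _ => by simpa using hasDerivWithinAt_const r (Set.Ici r) (0 : ℂ))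
      (fun _ _ => Set.mem_univ _) h0 ⟨h, hs.2⟩
    have hr' : r ∈ Set.Icc 0 t := ⟨hs₀.1.trans hr.1, hr.2.le⟩
    exact (he r hr').mono_of_mem_nhdsWithin
      (Filter.mem_of_superset (Icc_mem_nhdsGE hr.2) (Set.Icc_subset_Icc_left hr'.1))
  · refine ODE_solution_unique_of_mem_Icc_left (v := fun s y => a s * y) (s := fun _ => Set.univ)
      (f := e) (g := fun _ => 0) (a := 0) (b := s₀) (K := K.toNNReal)
      (fun r hr => hlip r ⟨hr.1.le, hr.2.trans hs₀.2⟩)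
      (hc.mono (Set.Icc_subset_Icc_right hs₀.2)) (fun r hr => ?_) (fun _ _ => Set.mem_univ _)
      continuousOn_const (fun r _ => by simpa using hasDerivWithinAt_const r (Set.Iic r) (0 : ℂ))
      (fun _ _ => Set.mem_univ _) h0 ⟨hs.1, h⟩
    have hr' : r ∈ Set.Icc 0 t := ⟨hr.1.le, hr.2.trans hs₀.2⟩
    exact (he r hr').mono_of_mem_nhdsWithin
      (Filter.mem_of_superset (Icc_mem_nhdsLE hr.1) (Set.Icc_subset_Icc_right hr'.2))

lemma stieltjes_dirac_one {z : ℂ} : stieltjes (Measure.dirac 1) z = (1 + z) / (1 - z) := by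
  simp [stieltjes]

section

variable {μ : ℝ → Measure Circle} (hμ : IsHydrodynamicLimit μ)
include hμ

lemma stieltjes_zero (z : ℂ) : stieltjes (μ 0) z = (1 + z) / (1 - z) := by
  rw [hμ.initial, stieltjes_dirac_one]

lemma hasDerivWithinAt_stieltjes_time {s : ℝ} (hs : 0 ≤ s) {z : ℂ} (hz : ‖z‖ < 1) :
    HasDerivWithinAt (fun s => stieltjes (μ s) z)
      (-(2 * z * stieltjes (μ s) z * stieltjesDeriv (μ s) z)) (Set.Ici 0) s := by
  have := hμ.isProbabilityMeasure s hs
  rw [← (hasDerivAt_stieltjes (ν := μ s) hz).deriv]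
  exact hμ.burgers s hs z (by simpa using hz)

lemma continuousOn_stieltjes_time {z : ℂ} (hz : ‖z‖ < 1) :
    ContinuousOn (fun s => stieltjes (μ s) z) (Set.Ici 0) := fun _ hs =>
  (hasDerivWithinAt_stieltjes_time hμ hs hz).continuousWithinAt

/-- Difference quotients in `z` are continuous in time and, by the uniform Taylor bound, converge to
the derivative uniformly in time. -/
lemma continuousOn_stieltjesDeriv_time {z : ℂ} (hz : ‖z‖ < 1) :
    ContinuousOn (fun s => stieltjesDeriv (μ s) z) (Set.Ici 0) := by
  obtain ⟨ρ, hzρ, hρ⟩ := exists_between hz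
  have hρ' : 0 < 1 - ρ := by linarith
  refine continuousOn_of_uniform_approx_of_continuousOn fun u hu => ?_
  obtain ⟨ε, hε, hu⟩ := Metric.mem_uniformity_dist.1 hu
  set C := 2 / (1 - ρ) ^ 3
  have hC : 0 < C := by positivity
  obtain ⟨k, hk0, hk⟩ := exists_between (lt_min (sub_pos.2 hzρ) (div_pos hε hC))
  have hk1 : k < ρ - ‖z‖ := hk.trans_le (min_le_left _ _)
  have hk2 : C * k < ε := by
    have := hk.trans_le (min_le_right _ _)
    rwa [lt_div_iff₀ hC, mul_comm] at this
  have hzk : ‖z + k‖ ≤ ρ := by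
    refine (norm_add_le _ _).trans ?_
    rw [Complex.norm_real, Real.norm_of_nonneg hk0.le]
    linarith
  refine ⟨fun s => (stieltjes (μ s) (z + k) - stieltjes (μ s) z) / k, ?_, fun s hs => hu ?_⟩
  · exact ((continuousOn_stieltjes_time hμ (hzk.trans_lt hρ)).sub
      (continuousOn_stieltjes_time hμ hz)).div_const _
  · have := hμ.isProbabilityMeasure s hs
    have h := norm_stieltjes_sub_sub_le (ν := μ s) hρ hzρ.le hzk
    have hkC : (k : ℂ) ≠ 0 := by exact_mod_cast hk0.ne'
    rw [add_sub_cancel_left, Complex.norm_real, Real.norm_of_nonneg hk0.le] at h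
    rw [dist_comm, dist_eq_norm]
    have e : (stieltjes (μ s) (z + k) - stieltjes (μ s) z) / k - stieltjesDeriv (μ s) z =
      (stieltjes (μ s) (z + k) - stieltjes (μ s) z - stieltjesDeriv (μ s) z * k) / k := by
      field_simp
    rw [e, norm_div, Complex.norm_real, Real.norm_of_nonneg hk0.le, div_lt_iff₀ hk0]
    nlinarith

/-- The chain rule for the Stieltjes transform along a curve in the disk. -/
lemma hasDerivWithinAt_stieltjes_comp {I : Set ℝ} (hI : I ⊆ Set.Ici 0) {ρ : ℝ} (hρ : ρ < 1)
    {z : ℝ → ℂ} {z' : ℂ} {s : ℝ} (hs : s ∈ I) (hz : ∀ r ∈ I, ‖z r‖ ≤ ρ)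
    (hd : HasDerivWithinAt z z' I s) :
    HasDerivWithinAt (fun r => stieltjes (μ r) (z r))
      (stieltjesDeriv (μ s) (z s) * (z' - 2 * z s * stieltjes (μ s) (z s))) I s := by
  have hzs : ‖z s‖ < 1 := (hz s hs).trans_lt hρ
  -- Split `M_r(z_r)` as `M_r(z_s)`, plus `M_r'(z_s) (z_r - z_s)`, plus a quadratic remainder. The
  -- middle factor `M_r'(z_s)` need only be continuous in `r`, as `z_r - z_s = O(r - s)`.
  have h1 := (hasDerivWithinAt_stieltjes_time hμ (hI hs) hzs).mono hI
  have hO : (fun r => z r - z s) =O[nhdsWithin s I] fun r => r - s :=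
    hd.hasFDerivWithinAt.isBigO_sub
  have ht : Filter.Tendsto (fun r => r - s) (nhdsWithin s I) (nhds 0) := by
    have : Filter.Tendsto (fun r => r - s) (nhds s) (nhds (s - s)) :=
      (continuous_id.sub continuous_const).tendsto s
    rw [sub_self] at this
    exact this.mono_left nhdsWithin_le_nhds
  have h2 : HasDerivWithinAt (fun r => stieltjesDeriv (μ r) (z s) * (z r - z s))
      (stieltjesDeriv (μ s) (z s) * z') I s := by
    have hN := (continuousOn_stieltjesDeriv_time hμ hzs s (hI hs)).mono hI
    have ho : (fun r => stieltjesDeriv (μ r) (z s) - stieltjesDeriv (μ s) (z s))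
        =o[nhdsWithin s I] fun _ => (1 : ℝ) := by
      rw [Asymptotics.isLittleO_one_iff]
      simpa using hN.tendsto.sub_const (stieltjesDeriv (μ s) (z s))
    have h3 : HasDerivWithinAt (fun r => (stieltjesDeriv (μ r) (z s) -
        stieltjesDeriv (μ s) (z s)) * (z r - z s)) 0 I s := by
      rw [hasDerivWithinAt_iff_isLittleO]
      simpa using ho.mul_isBigO hO
    have h4 := (hd.sub_const (z s)).const_mul (stieltjesDeriv (μ s) (z s))
    have := h3.add h4
    rw [zero_add] at this
    refine this.congr_of_mem (fun r _ => ?_) hs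
    simp only [Pi.add_apply]
    ring
  have h3 : HasDerivWithinAt (fun r => stieltjes (μ r) (z r) - stieltjes (μ r) (z s) -
      stieltjesDeriv (μ r) (z s) * (z r - z s)) 0 I s := by
    rw [hasDerivWithinAt_iff_isLittleO]
    have hb : (fun r => stieltjes (μ r) (z r) - stieltjes (μ r) (z s) -
        stieltjesDeriv (μ r) (z s) * (z r - z s)) =O[nhdsWithin s I]
        fun r => ‖z r - z s‖ ^ 2 := by
      refine Asymptotics.IsBigO.of_bound (2 / (1 - ρ) ^ 3) ?_
      filter_upwards [self_mem_nhdsWithin] with r hr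
      have := hμ.isProbabilityMeasure r (hI hr)
      rw [norm_pow, norm_norm]
      exact norm_stieltjes_sub_sub_le hρ (hz s hs) (hz r hr)
    have hb2 : (fun r => ‖z r - z s‖ ^ 2) =O[nhdsWithin s I] fun r => ‖r - s‖ ^ 2 :=
      hO.norm_norm.pow 2
    simp only [smul_zero, sub_zero, sub_self, mul_zero]
    exact (hb.trans hb2).trans_isLittleO
      ((Asymptotics.isLittleO_norm_pow_id one_lt_two).comp_tendsto ht)
  refine (((h1.add h2).add h3).congr_of_mem (fun r _ => ?_) hs).congr_deriv ?_
  · simp only [Pi.add_apply]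
    ring
  · ring

/-- The Stieltjes transform is constant along the straight characteristics `z₀ exp (2 s c)` of the
Burgers equation. -/
lemma stieltjes_characteristic {t ρ : ℝ} (hρ : ρ < 1) {z₀ c : ℂ}
    (hz : ∀ s ∈ Set.Icc 0 t, ‖z₀ * Complex.exp (2 * s * c)‖ ≤ ρ) {s₀ : ℝ}
    (hs₀ : s₀ ∈ Set.Icc 0 t) (h0 : stieltjes (μ s₀) (z₀ * Complex.exp (2 * s₀ * c)) = c) :
    ∀ s ∈ Set.Icc 0 t, stieltjes (μ s) (z₀ * Complex.exp (2 * s * c)) = c := by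
  set z : ℝ → ℂ := fun s => z₀ * Complex.exp (2 * s * c) with hzdef
  have hd : ∀ s : ℝ, HasDerivAt z (2 * c * z s) s := by
    intro s
    have h1 : HasDerivAt (fun s : ℝ => 2 * (s : ℂ) * c) (2 * c) s := by
      simpa using ((Complex.ofRealCLM.hasDerivAt (x := s)).const_mul 2).mul_const c
    refine (h1.cexp.const_mul z₀).congr_deriv ?_
    simp only [hzdef]
    ring
  -- The defect `e(s) = M_s(z_s) - c` satisfies the linear equation `e' = -2 z_s M_s'(z_s) e`, so
  -- one zero forces `e` to vanish identically.
  have key := eq_zero_of_hasDerivWithinAt_mul (t := t) (K := 2 * (2 / (1 - ρ) ^ 2))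
    (e := fun s => stieltjes (μ s) (z s) - c)
    (a := fun s => -(2 * z s * stieltjesDeriv (μ s) (z s))) (fun s hs => ?_) (fun s hs => ?_)
    hs₀ (sub_eq_zero.2 h0)
  · exact fun s hs => sub_eq_zero.1 (key s hs)
  · have := hasDerivWithinAt_stieltjes_comp hμ (I := Set.Icc 0 t) (fun s hs => hs.1) hρ hs hz
      (hd s).hasDerivWithinAt
    refine (this.sub_const c).congr_deriv ?_
    ring
  · have := hμ.isProbabilityMeasure s hs.1
    rw [norm_neg, mul_assoc, norm_mul, norm_mul]
    have hN := norm_stieltjesDeriv_le (ν := μ s) hρ (hz s hs)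
    have hz1 : ‖z s‖ ≤ 1 := (hz s hs).trans hρ.le
    have : ‖z s‖ * ‖stieltjesDeriv (μ s) (z s)‖ ≤ 1 * (2 / (1 - ρ) ^ 2) := by gcongr
    rw [Complex.norm_ofNat]
    linarith

end

/-! ### Inverting `Ω_t` along characteristics -/

lemma re_one_add_div_one_sub_nonneg {z : ℂ} (hz : ‖z‖ < 1) : 0 ≤ ((1 + z) / (1 - z)).re := by
  rw [← stieltjes_dirac_one]
  exact stieltjes_re_nonneg hz

lemma norm_exp_real_mul (s : ℝ) (c : ℂ) : ‖Complex.exp (2 * s * c)‖ = Real.exp (2 * s * c.re) := by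
  rw [Complex.norm_exp]
  simp

section

variable {μ : ℝ → Measure Circle} (hμ : IsHydrodynamicLimit μ) {t : ℝ} (ht : 0 ≤ t)
include hμ ht

/-- The modulus is nondecreasing along the characteristic because `Re M_0 ≥ 0`, so its endpoint
bounds the whole path. -/
lemma stieltjes_Omega {z : ℂ} (hz : ‖z‖ < 1) (hO : ‖Omega t z‖ < 1) :
    stieltjes (μ t) (Omega t z) = (1 + z) / (1 - z) := by
  refine stieltjes_characteristic hμ hO (fun s hs => ?_) (s₀ := 0) ⟨le_rfl, ht⟩ ?_ t ⟨ht, le_rfl⟩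
  · rw [Omega, norm_mul, norm_mul, norm_exp_real_mul, norm_exp_real_mul]
    have := re_one_add_div_one_sub_nonneg hz
    gcongr
    exact hs.2
  · simp [stieltjes_zero hμ]

lemma stieltjes_zero_backward {w : ℂ} (hw : ‖w‖ < 1) :
    ‖w * Complex.exp (-(2 * t * stieltjes (μ t) w))‖ < 1 ∧
      Omega t (w * Complex.exp (-(2 * t * stieltjes (μ t) w))) = w := by
  have := hμ.isProbabilityMeasure t ht
  set c := stieltjes (μ t) w with hc
  have hcre : 0 ≤ c.re := stieltjes_re_nonneg hw
  have hs : ∀ s : ℝ, w * Complex.exp (-(2 * t * c)) * Complex.exp (2 * s * c) =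
      w * Complex.exp (2 * (s - t : ℝ) * c) := by
    intro s
    rw [mul_assoc, ← Complex.exp_add]
    congr 2
    push_cast
    ring
  have hb : ∀ s ∈ Set.Icc 0 t,
      ‖w * Complex.exp (-(2 * t * c)) * Complex.exp (2 * s * c)‖ ≤ ‖w‖ := by
    intro s hs'
    rw [hs, norm_mul, norm_exp_real_mul]
    refine mul_le_of_le_one_right (norm_nonneg _) (Real.exp_le_one_iff.2 ?_)
    have := hs'.2
    nlinarith
  have h := stieltjes_characteristic hμ hw hb (s₀ := t) ⟨ht, le_rfl⟩ (by rw [hs]; simp [hc]) 0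
    ⟨le_rfl, ht⟩
  have hb0 := hb 0 ⟨le_rfl, ht⟩
  simp only [Complex.ofReal_zero, mul_zero, zero_mul, Complex.exp_zero, mul_one] at h hb0
  rw [stieltjes_zero hμ] at h
  refine ⟨hb0.trans_lt hw, ?_⟩
  rw [Omega, h, hs]
  simp

end

/-! ### The Loewner flow reaches every point of the disk -/

/-- The point of the left half-plane with real part `-|u.re|` and imaginary part `-u.im`. -/
def negFold (u : ℂ) : ℂ := ⟨-|u.re|, -u.im⟩

lemma norm_negFold_sub_le (u v : ℂ) : ‖negFold u - negFold v‖ ≤ ‖u - v‖ := by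
  rw [Complex.norm_eq_sqrt_sq_add_sq, Complex.norm_eq_sqrt_sq_add_sq]
  refine Real.sqrt_le_sqrt ?_
  simp only [negFold, Complex.sub_re, Complex.sub_im]
  have := sq_le_sq' (neg_le_of_abs_le (abs_abs_sub_abs_le u.re v.re))
    (le_of_abs_le (abs_abs_sub_abs_le u.re v.re))
  rw [sq_abs] at this
  linarith

lemma norm_exp_sub_exp_le {a b : ℂ} (ha : a.re ≤ 0) (hb : b.re ≤ 0) :
    ‖Complex.exp a - Complex.exp b‖ ≤ ‖a - b‖ := by
  have := (convex_halfSpace_re_le 0).norm_image_sub_le_of_norm_hasDerivWithin_le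
    (f := Complex.exp) (f' := Complex.exp) (C := 1)
    (fun x _ => (Complex.hasDerivAt_exp x).hasDerivWithinAt)
    (fun x hx => by
      rw [Complex.norm_exp]
      exact Real.exp_le_one_iff.2 hx) hb ha
  simpa using this

lemma norm_mul_exp_le (v : ℂ) {a : ℂ} (ha : a.re ≤ 0) : ‖v * Complex.exp a‖ ≤ ‖v‖ := by
  rw [norm_mul, Complex.norm_exp]
  exact mul_le_of_le_one_right (norm_nonneg _) (Real.exp_le_one_iff.2 ha)

lemma negFold_re_nonpos (u : ℂ) : (negFold u).re ≤ 0 := by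
  simp [negFold]

lemma negFold_of_nonneg {u : ℂ} (hu : 0 ≤ u.re) : negFold u = -u := by
  apply Complex.ext <;> simp [negFold, abs_of_nonneg hu]

lemma IsLoewnerSolution.exists_norm_le {μ : ℝ → Measure Circle} {t : ℝ} (ht : 0 ≤ t) {z : ℂ} {w : ℝ → ℂ}
    (hw : IsLoewnerSolution μ t z w) :
    ∃ ρ < 1, ∀ s ∈ Set.Icc 0 t, ‖w s‖ ≤ ρ := by
  have hc : ContinuousOn (fun s => ‖w s‖) (Set.Icc 0 t) := fun s hs =>
    (hw.2 s hs).2.continuousWithinAt.norm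
  obtain ⟨s, hs, hmax⟩ := isCompact_Icc.exists_isMaxOn ⟨0, le_rfl, ht⟩ hc
  exact ⟨‖w s‖, mem_ball_zero_iff.1 (hw.2 s hs).1, fun r hr => hmax hr⟩

section

variable {μ : ℝ → Measure Circle} (hμ : IsHydrodynamicLimit μ) {t : ℝ} (ht : 0 ≤ t)
include hμ ht

/-- Every point of the disk is the value at time `t` of a solution of the Loewner equation. -/
lemma exists_isLoewnerSolution {v : ℂ} (hv : ‖v‖ < 1) :
    ∃ w : ℝ → ℂ, IsLoewnerSolution μ t (w 0) w ∧ w t = v := by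
  have hv' : 0 < 1 - ‖v‖ := by linarith
  -- With `w = v exp(-u)` the Loewner equation becomes `u' = -M_s(v exp(-u))`, `u(t) = 0`. Replacing
  -- `-u` by `negFold u` makes the field bounded and Lipschitz for all `u`, so Picard–Lindelöf
  -- covers all of `[0, t]`.
  set G : ℝ → ℂ → ℂ := fun s u => -stieltjes (μ s) (v * Complex.exp (negFold u)) with hG
  have hin : ∀ u, ‖v * Complex.exp (negFold u)‖ ≤ ‖v‖ := fun u =>
    norm_mul_exp_le v (negFold_re_nonpos u)
  set L : NNReal := ⟨2 / (1 - ‖v‖), by positivity⟩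
  set K : NNReal := ⟨2 / (1 - ‖v‖) ^ 2, by positivity⟩
  set T : NNReal := ⟨t, ht⟩
  have hPL : IsPicardLindelof G (tmin := 0) (tmax := t) ⟨t, ht, le_rfl⟩ 0 (L * T) 0 L K := by
    refine ⟨fun s hs => ?_, fun u _ => ?_, fun s hs u _ => ?_, ?_⟩
    · refine LipschitzOnWith.of_dist_le_mul fun x _ y _ => ?_
      have := hμ.isProbabilityMeasure s hs.1
      rw [dist_eq_norm, dist_eq_norm, hG]
      simp only [neg_sub_neg]
      rw [norm_sub_rev]
      refine (norm_stieltjes_sub_le hv (hin y) (hin x)).trans ?_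
      change 2 / (1 - ‖v‖) ^ 2 * _ ≤ 2 / (1 - ‖v‖) ^ 2 * _
      gcongr
      rw [← mul_sub, norm_mul]
      calc ‖v‖ * ‖Complex.exp (negFold x) - Complex.exp (negFold y)‖ ≤ 1 * ‖x - y‖ := by
            gcongr
            exact (norm_exp_sub_exp_le (negFold_re_nonpos x) (negFold_re_nonpos y)).trans
              (norm_negFold_sub_le x y)
        _ = ‖x - y‖ := one_mul _
    · exact ((continuousOn_stieltjes_time hμ ((hin u).trans_lt hv)).mono
        fun s hs => hs.1).neg
    · have := hμ.isProbabilityMeasure s hs.1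
      rw [hG, norm_neg]
      exact norm_stieltjes_le hv (hin u)
    · simp only [sub_self, sub_zero, max_eq_right ht, NNReal.coe_zero]
      exact le_rfl
  obtain ⟨u, hut, hu⟩ := hPL.exists_eq_forall_mem_Icc_hasDerivWithinAt₀
  replace hut : u t = 0 := hut
  have hre : ∀ s ∈ Set.Icc 0 t, HasDerivWithinAt (fun s => (u s).re) (G s (u s)).re
      (Set.Icc 0 t) s := fun s hs =>
    (Complex.reCLM.hasFDerivAt.comp_hasDerivWithinAt s (hu s hs))
  -- `Re u` decreases to `0` at time `t`, hence is nonnegative: the fold was inactive and `u` solves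
  -- the original equation.
  have hanti : AntitoneOn (fun s => (u s).re) (Set.Icc 0 t) := by
    refine antitoneOn_of_hasDerivWithinAt_nonpos (convex_Icc 0 t)
      (fun s hs => (hre s hs).continuousWithinAt)
      (fun s hs => (hre s (interior_subset hs)).mono interior_subset) fun s hs => ?_
    have := hμ.isProbabilityMeasure s (interior_subset hs).1
    simp only [hG, Complex.neg_re, neg_nonpos]
    exact stieltjes_re_nonneg ((hin _).trans_lt hv)
  have hpos : ∀ s ∈ Set.Icc 0 t, 0 ≤ (u s).re := fun s hs => by
    have := hanti hs ⟨ht, le_rfl⟩ hs.2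
    simpa [hut] using this
  refine ⟨fun s => v * Complex.exp (-u s), ⟨rfl, fun s hs => ⟨?_, ?_⟩⟩, by simp [hut]⟩
  · rw [mem_ball_zero_iff]
    exact (norm_mul_exp_le v (by simpa using hpos s hs)).trans_lt hv
  · refine ((hu s hs).neg.cexp.const_mul v).congr_deriv ?_
    simp only [hG, negFold_of_nonneg (hpos s hs), Pi.neg_apply]
    ring

/-- Makes `loewnerMap` independent of the chosen solution. By compactness both paths stay in one
disk of radius `ρ < 1`, where the field is Lipschitz uniformly in time. -/
lemma IsLoewnerSolution.eq {z : ℂ} {w₁ w₂ : ℝ → ℂ} (h₁ : IsLoewnerSolution μ t z w₁)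
    (h₂ : IsLoewnerSolution μ t z w₂) : w₁ t = w₂ t := by
  obtain ⟨ρ₁, hρ₁, hb₁⟩ := h₁.exists_norm_le ht
  obtain ⟨ρ₂, hρ₂, hb₂⟩ := h₂.exists_norm_le ht
  set ρ := max ρ₁ ρ₂
  have hρ : ρ < 1 := max_lt hρ₁ hρ₂
  have hρ' : 0 < 1 - ρ := by linarith
  have hd : ∀ w, IsLoewnerSolution μ t z w → ∀ s ∈ Set.Ico 0 t,
      HasDerivWithinAt w (w s * stieltjes (μ s) (w s)) (Set.Ici s) s := fun w hw s hs =>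
    (hw.2 s ⟨hs.1, hs.2.le⟩).2.mono_of_mem_nhdsWithin
      (Filter.mem_of_superset (Icc_mem_nhdsGE hs.2) (Set.Icc_subset_Icc_left hs.1))
  refine ODE_solution_unique_of_mem_Icc_right (v := fun s y => y * stieltjes (μ s) y)
    (s := fun _ => Metric.closedBall 0 ρ) (a := 0) (b := t)
    (K := ⟨2 / (1 - ρ) + 2 / (1 - ρ) ^ 2, by positivity⟩) (fun s hs => ?_)
    (fun s hs => (h₁.2 s hs).2.continuousWithinAt) (hd w₁ h₁)
    (fun s hs => mem_closedBall_zero_iff.2 ((hb₁ s ⟨hs.1, hs.2.le⟩).trans (le_max_left _ _)))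
    (fun s hs => (h₂.2 s hs).2.continuousWithinAt) (hd w₂ h₂)
    (fun s hs => mem_closedBall_zero_iff.2 ((hb₂ s ⟨hs.1, hs.2.le⟩).trans (le_max_right _ _)))
    (h₁.1.trans h₂.1.symm) ⟨ht, le_rfl⟩
  refine LipschitzOnWith.of_dist_le_mul fun x hx y hy => ?_
  have := hμ.isProbabilityMeasure s hs.1
  rw [mem_closedBall_zero_iff] at hx hy
  rw [dist_eq_norm, dist_eq_norm]
  have e : x * stieltjes (μ s) x - y * stieltjes (μ s) y =
      (x - y) * stieltjes (μ s) x + y * (stieltjes (μ s) x - stieltjes (μ s) y) := by ring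
  rw [e]
  refine (norm_add_le _ _).trans ?_
  rw [norm_mul, norm_mul]
  have b1 := norm_stieltjes_le (ν := μ s) hρ hx
  have b2 := norm_stieltjes_sub_le (ν := μ s) hρ hy hx
  calc ‖x - y‖ * ‖stieltjes (μ s) x‖ + ‖y‖ * ‖stieltjes (μ s) x - stieltjes (μ s) y‖
      ≤ ‖x - y‖ * (2 / (1 - ρ)) + 1 * (2 / (1 - ρ) ^ 2 * ‖x - y‖) := by
        gcongr
        exact hy.trans hρ.le
    _ = (2 / (1 - ρ) + 2 / (1 - ρ) ^ 2) * ‖x - y‖ := by ring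

/-- The Loewner map at time `t` is onto the disk. -/
lemma image_loewnerMap : loewnerMap μ t '' loewnerDomain μ t = Metric.ball 0 1 := by
  apply Set.Subset.antisymm
  · rintro _ ⟨z, ⟨-, h⟩, rfl⟩
    rw [loewnerMap, dif_pos h]
    exact (h.choose_spec.2 t ⟨ht, le_rfl⟩).1
  · intro v hv
    obtain ⟨w, hw, hwt⟩ := exists_isLoewnerSolution hμ ht (mem_ball_zero_iff.1 hv)
    have h : ∃ w', IsLoewnerSolution μ t (w 0) w' := ⟨w, hw⟩
    refine ⟨w 0, ⟨(hw.2 0 ⟨le_rfl, ht⟩).1, h⟩, ?_⟩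
    rw [loewnerMap, dif_pos h, ← hwt]
    exact h.choose_spec.eq hμ ht hw

end

/-! ### Identification of `h_t(𝔻_t)` -/

/-- The part of the unit disk that `Ω_t` maps into the unit disk. -/
def subunitDomain (t : ℝ) : Set ℂ := {z | ‖z‖ < 1 ∧ ‖Omega t z‖ < 1}

lemma zero_mem_subunitDomain (t : ℝ) : (0 : ℂ) ∈ subunitDomain t := by
  simp [subunitDomain, Omega]

lemma differentiableAt_Omega (t : ℝ) {z : ℂ} (hz : z ≠ 1) : DifferentiableAt ℂ (Omega t) z := by
  have : 1 - z ≠ 0 := sub_ne_zero.2 hz.symm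
  unfold Omega
  fun_prop (disch := assumption)

lemma ne_one_of_norm_lt {z : ℂ} (hz : ‖z‖ < 1) : z ≠ 1 := by
  rintro rfl
  simp at hz

lemma continuousOn_Omega (t : ℝ) : ContinuousOn (Omega t) (Metric.ball 0 1) := fun _ hz =>
  (differentiableAt_Omega t
    (ne_one_of_norm_lt (mem_ball_zero_iff.1 hz))).continuousAt.continuousWithinAt

lemma subunitDomain_eq (t : ℝ) :
    subunitDomain t = Metric.ball 0 1 ∩ Omega t ⁻¹' Metric.ball 0 1 := by
  ext z
  simp [subunitDomain]

lemma isOpen_subunitDomain (t : ℝ) : IsOpen (subunitDomain t) := by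
  rw [subunitDomain_eq]
  exact (continuousOn_Omega t).isOpen_inter_preimage Metric.isOpen_ball Metric.isOpen_ball

section

variable {μ : ℝ → Measure Circle} (hμ : IsHydrodynamicLimit μ) {t : ℝ} (ht : 0 ≤ t)
include hμ ht

lemma image_mul_exp_stieltjes :
    (fun w => w * Complex.exp (-(2 * (t : ℂ) * stieltjes (μ t) w))) '' Metric.ball 0 1 =
      subunitDomain t := by
  apply Set.Subset.antisymm
  · rintro _ ⟨w, hw, rfl⟩
    rw [mem_ball_zero_iff] at hw
    obtain ⟨h1, h2⟩ := stieltjes_zero_backward hμ ht hw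
    exact ⟨h1, by rwa [h2]⟩
  · rintro z ⟨hz, hO⟩
    refine ⟨Omega t z, mem_ball_zero_iff.2 hO, ?_⟩
    simp only [stieltjes_Omega hμ ht hz hO]
    rw [Omega, mul_assoc, ← Complex.exp_add]
    simp

lemma tildeDomain_eq_subunitDomain : tildeDomain μ t = subunitDomain t := by
  rw [← image_mul_exp_stieltjes hμ ht, ← image_loewnerMap hμ ht, Set.image_image]
  rfl

lemma isPreconnected_subunitDomain : IsPreconnected (subunitDomain t) := by
  rw [← image_mul_exp_stieltjes hμ ht]
  refine (convex_ball (0 : ℂ) 1).isPreconnected.image _ fun w hw => ?_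
  have := hμ.isProbabilityMeasure t ht
  have hM : ContinuousAt (stieltjes (μ t)) w :=
    (hasDerivAt_stieltjes (mem_ball_zero_iff.1 hw)).continuousAt
  exact ContinuousAt.continuousWithinAt (by fun_prop)

lemma mapsConformallyOnto_subunitDomain :
    MapsConformallyOnto (Omega t) (subunitDomain t) (Metric.ball 0 1) := by
  refine ⟨isOpen_subunitDomain t, fun z hz =>
    (differentiableAt_Omega t (ne_one_of_norm_lt hz.1)).differentiableWithinAt,
    fun z hz => mem_ball_zero_iff.2 hz.2, fun z hz z' hz' h => ?_, fun w hw => ?_⟩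
  · have e : ∀ z ∈ subunitDomain t,
        Omega t z * Complex.exp (-(2 * (t : ℂ) * stieltjes (μ t) (Omega t z))) = z := by
      intro z hz
      rw [stieltjes_Omega hμ ht hz.1 hz.2, Omega, mul_assoc, ← Complex.exp_add]
      simp
    rw [← e z hz, ← e z' hz', h]
  · obtain ⟨h1, h2⟩ := stieltjes_zero_backward hμ ht (mem_ball_zero_iff.1 hw)
    exact ⟨_, ⟨h1, by rw [h2]; exact mem_ball_zero_iff.1 hw⟩, h2⟩

end

/-! ### Uniqueness of the conformal domain -/

lemma nhds_le_map_of_injOn {f : ℂ → ℂ} {U : Set ℂ} (hU : IsOpen U) (hd : DifferentiableOn ℂ f U)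
    (hi : Set.InjOn f U) {z : ℂ} (hz : z ∈ U) : nhds (f z) ≤ Filter.map f (nhds z) := by
  have hUz := hU.mem_nhds hz
  refine (hd.analyticAt hUz).eventually_constant_or_nhds_le_map_nhds.resolve_left fun h => ?_
  have h' : ∀ᶠ x in nhdsWithin z {z}ᶜ, False := by
    filter_upwards [h.filter_mono nhdsWithin_le_nhds, nhdsWithin_le_nhds hUz,
      self_mem_nhdsWithin] with x hx hxU hne
    exact hne (hi hxU hz hx)
  exact Filter.NeBot.ne inferInstance (Filter.eventually_false_iff_eq_bot.1 h')

/-- Two domains that meet and that a map sends conformally onto the same connected set agree. -/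
lemma MapsConformallyOnto.eq {f : ℂ → ℂ} {U V W : Set ℂ} (hU : MapsConformallyOnto f U W)
    (hV : MapsConformallyOnto f V W) (hW : IsPreconnected W) (hne : (U ∩ V).Nonempty) : U = V := by
  obtain ⟨hUo, hUd, hUm, hUi, hUs⟩ := hU
  obtain ⟨hVo, hVd, hVm, hVi, hVs⟩ := hV
  set A := f '' (U ∩ V)
  have hA : IsOpen A := by
    rw [isOpen_iff_mem_nhds]
    rintro _ ⟨z, hz, rfl⟩
    exact nhds_le_map_of_injOn hUo hUd hUi hz.1
      (Filter.image_mem_map ((hUo.inter hVo).mem_nhds hz))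
  -- A value outside `A` has distinct preimages in `U` and `V`. Nearby values keep theirs in
  -- disjoint neighbourhoods, so by injectivity no common preimage appears.
  have hB : IsOpen (W \ A) := by
    rw [isOpen_iff_mem_nhds]
    rintro w ⟨hw, hwA⟩
    obtain ⟨u, hu, rfl⟩ := hUs hw
    obtain ⟨v, hv, hvu⟩ := hVs hw
    have huv : u ≠ v := by
      rintro rfl
      exact hwA ⟨u, ⟨hu, hv⟩, rfl⟩
    obtain ⟨N, N', hN, hN', huN, hvN', hd⟩ := t2_separation huv
    have h1 := nhds_le_map_of_injOn hUo hUd hUi hu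
      (Filter.image_mem_map ((hUo.inter hN).mem_nhds ⟨hu, huN⟩))
    have h2 := nhds_le_map_of_injOn hVo hVd hVi hv
      (Filter.image_mem_map ((hVo.inter hN').mem_nhds ⟨hv, hvN'⟩))
    rw [hvu] at h2
    filter_upwards [h1, h2]
    rintro _ ⟨x, ⟨hxU, hxN⟩, rfl⟩ ⟨y, ⟨hyV, hyN'⟩, hyx⟩
    refine ⟨hUm hxU, ?_⟩
    rintro ⟨p, ⟨hpU, hpV⟩, hpx⟩
    have e1 : p = x := hUi hpU hxU hpx
    have e2 : p = y := hVi hpV hyV (hpx.trans hyx.symm)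
    exact Set.disjoint_left.1 hd hxN (e1 ▸ e2 ▸ hyN')
  have hWA : W ⊆ A := by
    refine hW.subset_left_of_subset_union hA hB Set.disjoint_sdiff_right
      (fun w hw => or_iff_not_imp_left.2 fun h => ⟨hw, h⟩) ?_
    obtain ⟨z, hz⟩ := hne
    exact ⟨f z, hUm hz.1, z, hz, rfl⟩
  apply Set.Subset.antisymm
  · intro z hz
    obtain ⟨p, hp, hpz⟩ := hWA (hUm hz)
    exact hUi hp.1 hz hpz ▸ hp.2
  · intro z hz
    obtain ⟨p, hp, hpz⟩ := hWA (hVm hz)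
    exact hVi hp.2 hz hpz ▸ hp.1

/-! ### The admissible radii -/

/-- The function whose level set defines `rMin`. -/
def timeMin (r : ℝ) : ℝ := -((1 - r) / (2 * (1 + r)) * Real.log r)

/-- The function whose level set defines `rMax`. -/
def timeMax (r : ℝ) : ℝ := -((1 + r) / (2 * (1 - r)) * Real.log r)

/-- `F` is affine in `t` with negative slope, so `-1 ≤ F t r ≤ 1` amounts to `timeMin r ≤ t ≤
timeMax r`. -/
lemma F_sub_one {r : ℝ} (h0 : 0 < r) (h1 : r < 1) (t : ℝ) :
    F t r - 1 = (1 - r ^ 2) / (r * Real.log r) * (t - timeMin r) := by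
  have hl : Real.log r ≠ 0 := (Real.log_neg h0 h1).ne
  have : 1 + r ≠ 0 := by positivity
  unfold F timeMin
  field_simp
  ring

lemma F_add_one {r : ℝ} (h0 : 0 < r) (h1 : r < 1) (t : ℝ) :
    F t r + 1 = (1 - r ^ 2) / (r * Real.log r) * (t - timeMax r) := by
  have hl : Real.log r ≠ 0 := (Real.log_neg h0 h1).ne
  have : 1 - r ≠ 0 := by linarith
  unfold F timeMax
  field_simp
  ring

lemma F_coeff_neg {r : ℝ} (h0 : 0 < r) (h1 : r < 1) : (1 - r ^ 2) / (r * Real.log r) < 0 := by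
  have hl := Real.log_neg h0 h1
  refine div_neg_of_pos_of_neg (by nlinarith) (mul_neg_of_pos_of_neg h0 hl)

lemma F_le_one_iff {r : ℝ} (h0 : 0 < r) (h1 : r < 1) {t : ℝ} : F t r ≤ 1 ↔ timeMin r ≤ t := by
  have h := F_sub_one h0 h1 t
  have hc := F_coeff_neg h0 h1
  rw [← sub_nonpos, h, mul_nonpos_iff]
  constructor
  · rintro (⟨h, -⟩ | ⟨-, h⟩) <;> linarith
  · intro h
    exact Or.inr ⟨hc.le, by linarith⟩

lemma neg_one_le_F_iff {r : ℝ} (h0 : 0 < r) (h1 : r < 1) {t : ℝ} :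
    -1 ≤ F t r ↔ t ≤ timeMax r := by
  have h := F_add_one h0 h1 t
  have hc := F_coeff_neg h0 h1
  rw [neg_le_iff_add_nonneg, h, mul_nonneg_iff]
  constructor
  · rintro (⟨h, -⟩ | ⟨-, h⟩) <;> linarith
  · intro h
    exact Or.inr ⟨hc.le, by linarith⟩

lemma strictAntiOn_timeMin : StrictAntiOn timeMin (Set.Ioc 0 1) := by
  intro r hr s hs hrs
  have hr0 := hr.1
  have hs0 := hs.1
  have h1 : (1 - s) / (2 * (1 + s)) < (1 - r) / (2 * (1 + r)) := by
    rw [div_lt_div_iff₀ (by positivity) (by positivity)]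
    nlinarith
  have h2 : -Real.log s < -Real.log r := neg_lt_neg (Real.log_lt_log hr0 hrs)
  have h3 : 0 ≤ (1 - s) / (2 * (1 + s)) := div_nonneg (by linarith [hs.2]) (by positivity)
  have h4 : 0 ≤ -Real.log s := neg_nonneg.2 (Real.log_nonpos hs0.le hs.2)
  unfold timeMin
  rw [← mul_neg, ← mul_neg]
  exact mul_lt_mul'' h1 h2 h3 h4

lemma exists_timeMin_eq {t : ℝ} (ht : 0 ≤ t) : ∃ r ∈ Set.Ioc (0 : ℝ) 1, timeMin r = t := by
  have hc : ContinuousOn timeMin (Set.Ioc 0 1) := fun r hr => by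
    have h1 : 2 * (1 + r) ≠ 0 := by have := hr.1; positivity
    have h2 : r ≠ 0 := hr.1.ne'
    unfold timeMin
    exact ContinuousAt.continuousWithinAt (by fun_prop (disch := assumption))
  -- Since `ε ≤ 1/2`, the rational factor of `timeMin ε` is at least `1/8`, which the `8` in the
  -- exponent compensates.
  set ε := Real.exp (-(8 * t + 1)) with hε
  have hε0 : 0 < ε := Real.exp_pos _
  have hε1 : ε ≤ 1 / 2 := by
    rw [hε, Real.exp_neg, one_div]
    have := Real.add_one_le_exp (8 * t + 1)
    exact inv_anti₀ two_pos (by linarith)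
  have h0 : timeMin 1 ≤ t := by simpa [timeMin] using ht
  have h1 : t ≤ timeMin ε := by
    have hl : Real.log ε = -(8 * t + 1) := Real.log_exp _
    have h8 : 1 / 8 ≤ (1 - ε) / (2 * (1 + ε)) := by
      rw [div_le_div_iff₀ (by norm_num) (by positivity)]
      linarith
    unfold timeMin
    rw [hl, ← mul_neg, neg_neg]
    calc t ≤ 1 / 8 * (8 * t + 1) := by linarith
      _ ≤ _ := by gcongr
  obtain ⟨r, hr, h⟩ := isPreconnected_Ioc.intermediate_value (a := 1) (b := ε)
    ⟨one_pos, le_rfl⟩ ⟨hε0, by linarith⟩ hc ⟨h0, h1⟩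
  exact ⟨r, hr, h⟩

lemma rMin_spec {t : ℝ} (ht : 0 ≤ t) : rMin t ∈ Set.Ioc (0 : ℝ) 1 ∧ timeMin (rMin t) = t := by
  obtain ⟨r, hr, h⟩ := exists_timeMin_eq ht
  have : rMin t = r := by
    rw [rMin, show {r : ℝ | 0 < r ∧ r ≤ 1 ∧ t = -((1 - r) / (2 * (1 + r)) * Real.log r)} = {r} from
      Set.eq_singleton_iff_unique_mem.2 ⟨⟨hr.1, hr.2, h.symm⟩, fun s hs =>
        strictAntiOn_timeMin.injOn ⟨hs.1, hs.2.1⟩ hr (hs.2.2.symm.trans h.symm)⟩,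
      csInf_singleton]
  rw [this]
  exact ⟨hr, h⟩

lemma timeMin_le_iff {t r : ℝ} (ht : 0 ≤ t) (hr : r ∈ Set.Ioc (0 : ℝ) 1) :
    timeMin r ≤ t ↔ rMin t ≤ r := by
  obtain ⟨h, h'⟩ := rMin_spec ht
  conv_lhs => rw [← h']
  exact strictAntiOn_timeMin.le_iff_ge hr h

/-- This is why the curve has no inner endpoint at angle `π` when `t ≤ 1`: the constraint `-1 ≤ F t
r` is then automatic. -/
lemma one_lt_timeMax {r : ℝ} (h0 : 0 < r) (h1 : r < 1) : 1 < timeMax r := by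
  have h := Real.lt_log_one_add_of_pos (x := r⁻¹ - 1) (sub_pos.2 ((one_lt_inv₀ h0).2 h1))
  rw [add_sub_cancel, Real.log_inv] at h
  have e : 2 * (r⁻¹ - 1) / (r⁻¹ - 1 + 2) = 2 * (1 - r) / (1 + r) := by
    rw [show r⁻¹ - 1 + 2 = (1 + r) / r by field_simp; ring]
    field_simp
  rw [e] at h
  have h2 : 0 < 1 - r := by linarith
  calc 1 = (1 + r) / (2 * (1 - r)) * (2 * (1 - r) / (1 + r)) := by field_simp
    _ < (1 + r) / (2 * (1 - r)) * -Real.log r := by gcongr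
    _ = timeMax r := mul_neg _ _

lemma hasDerivAt_timeMax {r : ℝ} (h0 : 0 < r) (h1 : r < 1) :
    HasDerivAt timeMax (-(1 / (1 - r) ^ 2 * Real.log r + (1 + r) / (2 * (1 - r)) * r⁻¹)) r := by
  have hr : 2 * (1 - r) ≠ 0 := by linarith
  have hn := (hasDerivAt_id r).const_add 1
  have hd := ((hasDerivAt_id r).const_sub 1).const_mul 2
  refine ((hn.div hd hr).mul (Real.hasDerivAt_log h0.ne')).neg.congr_deriv ?_
  have : 1 - r ≠ 0 := by linarith
  simp only [id, Pi.div_apply, neg_inj]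
  congr 2
  field_simp
  ring

/-- The rational factor increases, so a product argument fails. With `x = -log r` the derivative is
`(x - sinh x) / (1 - r)²`. -/
lemma strictAntiOn_timeMax : StrictAntiOn timeMax (Set.Ioo 0 1) := by
  refine strictAntiOn_of_deriv_neg (convex_Ioo 0 1)
    (fun r hr => (hasDerivAt_timeMax hr.1 hr.2).continuousAt.continuousWithinAt) fun r hr => ?_
  rw [interior_Ioo] at hr
  rw [(hasDerivAt_timeMax hr.1 hr.2).deriv]
  have h0 := hr.1
  have hs : 0 < 1 - r := by linarith [hr.2]
  have h : -Real.log r < Real.sinh (-Real.log r) :=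
    Real.self_lt_sinh_iff.2 (neg_pos.2 (Real.log_neg hr.1 hr.2))
  rw [Real.sinh_eq, neg_neg, Real.exp_neg, Real.exp_log h0] at h
  have e : -(1 / (1 - r) ^ 2 * Real.log r + (1 + r) / (2 * (1 - r)) * r⁻¹) =
      1 / (1 - r) ^ 2 * (-Real.log r - (r⁻¹ - r) / 2) := by
    field_simp
    ring
  rw [e]
  exact mul_neg_of_pos_of_neg (by positivity) (by linarith)

lemma exists_timeMax_eq {t : ℝ} (ht : 1 < t) : ∃ r ∈ Set.Ioo (0 : ℝ) 1, timeMax r = t := by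
  have hc : ContinuousOn timeMax (Set.Ioo 0 1) := fun r hr =>
    (hasDerivAt_timeMax hr.1 hr.2).continuousAt.continuousWithinAt
  -- This upper bound equals `t` at `r = (2t - 1)⁻¹`, which fixes the first endpoint for the
  -- intermediate value theorem.
  have hlo : ∀ r : ℝ, 0 < r → r < 1 → timeMax r ≤ (1 + r⁻¹) / 2 := by
    intro r h0 h1
    have hs : 0 < 1 - r := by linarith
    have hl : -Real.log r ≤ r⁻¹ - 1 := by
      rw [← Real.log_inv]
      exact Real.log_le_sub_one_of_pos (inv_pos.2 h0)
    calc timeMax r = (1 + r) / (2 * (1 - r)) * -Real.log r := (mul_neg _ _).symm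
      _ ≤ (1 + r) / (2 * (1 - r)) * (r⁻¹ - 1) := by gcongr
      _ = (1 + r⁻¹) / 2 := by
        field_simp
        ring
  have hr₁ : (2 * t - 1)⁻¹ ∈ Set.Ioo (0 : ℝ) 1 :=
    ⟨inv_pos.2 (by linarith), inv_lt_one_of_one_lt₀ (by linarith)⟩
  have h₁ : timeMax (2 * t - 1)⁻¹ ≤ t := by
    refine (hlo _ hr₁.1 hr₁.2).trans_eq ?_
    rw [inv_inv]
    ring
  have hr₂ : Real.exp (-(2 * t)) ∈ Set.Ioo (0 : ℝ) 1 :=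
    ⟨Real.exp_pos _, Real.exp_lt_one_iff.2 (by linarith)⟩
  have h₂ : t ≤ timeMax (Real.exp (-(2 * t))) := by
    have hs : 0 < 1 - Real.exp (-(2 * t)) := sub_pos.2 hr₂.2
    have h : 1 / 2 ≤ (1 + Real.exp (-(2 * t))) / (2 * (1 - Real.exp (-(2 * t)))) := by
      rw [div_le_div_iff₀ two_pos (by positivity)]
      linarith [hr₂.1]
    rw [timeMax, Real.log_exp, ← mul_neg, neg_neg]
    calc t = 1 / 2 * (2 * t) := by ring
      _ ≤ _ := by gcongr
  obtain ⟨r, hr, h⟩ := isPreconnected_Ioo.intermediate_value hr₁ hr₂ hc ⟨h₁, h₂⟩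
  exact ⟨r, hr, h⟩

lemma rMax_spec {t : ℝ} (ht : 1 < t) : rMax t ∈ Set.Ioo (0 : ℝ) 1 ∧ timeMax (rMax t) = t := by
  obtain ⟨r, hr, h⟩ := exists_timeMax_eq ht
  have : rMax t = r := by
    rw [rMax, show {r : ℝ | 0 < r ∧ r < 1 ∧ t = -((1 + r) / (2 * (1 - r)) * Real.log r)} = {r} from
      Set.eq_singleton_iff_unique_mem.2 ⟨⟨hr.1, hr.2, h.symm⟩, fun s hs =>
        strictAntiOn_timeMax.injOn ⟨hs.1, hs.2.1⟩ hr (hs.2.2.symm.trans h.symm)⟩,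
      csInf_singleton]
  rw [this]
  exact ⟨hr, h⟩

lemma le_timeMax_iff {t r : ℝ} (ht : 1 < t) (hr : r ∈ Set.Ioo (0 : ℝ) 1) :
    t ≤ timeMax r ↔ r ≤ rMax t := by
  obtain ⟨h, h'⟩ := rMax_spec ht
  conv_lhs => rw [← h']
  exact strictAntiOn_timeMax.le_iff_ge h hr

/-! ### The curve as the level set `|Ω_t| = 1` -/

lemma norm_sq_one_sub (z : ℂ) : ‖1 - z‖ ^ 2 = 1 - 2 * z.re + ‖z‖ ^ 2 := by
  rw [Complex.sq_norm, Complex.sq_norm, Complex.normSq_apply, Complex.normSq_apply]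
  simp only [Complex.sub_re, Complex.sub_im, Complex.one_re, Complex.one_im]
  ring

lemma one_add_div_one_sub_re (z : ℂ) :
    ((1 + z) / (1 - z)).re = (1 - ‖z‖ ^ 2) / ‖1 - z‖ ^ 2 := by
  rw [Complex.div_re, ← add_div, ← Complex.sq_norm]
  congr 1
  rw [Complex.sq_norm, Complex.normSq_apply]
  simp only [Complex.sub_re, Complex.sub_im, Complex.one_re, Complex.one_im, Complex.add_re,
    Complex.add_im]
  ring

/-- `log |Ω_t(z)|` times `|1 - z|²` is affine in `Re z` for fixed `|z|`; solving for its zero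
produces `F`. -/
lemma norm_Omega_eq_one_iff {t : ℝ} {z : ℂ} (h0 : 0 < ‖z‖) (h1 : ‖z‖ < 1) :
    ‖Omega t z‖ = 1 ↔ z.re = ‖z‖ * F t ‖z‖ := by
  have hl := (Real.log_neg h0 h1).ne
  have hd : 0 < ‖1 - z‖ := norm_pos_iff.2 (sub_ne_zero.2 (ne_one_of_norm_lt h1).symm)
  have hd2 := norm_sq_one_sub z
  have hO : ‖Omega t z‖ =
      Real.exp (Real.log ‖z‖ + 2 * t * ((1 - ‖z‖ ^ 2) / ‖1 - z‖ ^ 2)) := by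
    rw [Omega, norm_mul, norm_exp_real_mul, one_add_div_one_sub_re, Real.exp_add, Real.exp_log h0]
  have e : Real.log ‖z‖ + 2 * t * ((1 - ‖z‖ ^ 2) / ‖1 - z‖ ^ 2) =
      2 * Real.log ‖z‖ / ‖1 - z‖ ^ 2 * (‖z‖ * F t ‖z‖ - z.re) := by
    have : z.re = (1 + ‖z‖ ^ 2 - ‖1 - z‖ ^ 2) / 2 := by linarith
    rw [this]
    unfold F
    field_simp
    ring
  rw [hO, Real.exp_eq_one_iff, e, mul_eq_zero, sub_eq_zero, eq_comm (a := z.re)]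
  refine or_iff_right ?_
  exact div_ne_zero (mul_ne_zero two_ne_zero hl) (pow_ne_zero 2 hd.ne')

/-- `Real.arccos` clamps its argument, so the radii must be restricted to those where `F t r` is a
genuine cosine. -/
lemma mem_polarCurve_iff {t : ℝ} {I : Set ℝ} (hI : ∀ r, r ∈ I ↔ (r ∈ Set.Ioo (0 : ℝ) 1 ∧
    F t r ∈ Set.Icc (-1 : ℝ) 1)) {z : ℂ} (hz : ‖z‖ < 1) :
    z ∈ polarCurve t I ↔ ‖Omega t z‖ = 1 := by
  constructor
  · rintro ⟨r, hr, θ, hθ, rfl⟩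
    obtain ⟨⟨h0, h1⟩, hF⟩ := (hI r).1 hr
    have hn : ‖(r : ℂ) * Complex.exp (θ * Complex.I)‖ = r := by
      rw [norm_mul, Complex.norm_exp_ofReal_mul_I, Complex.norm_real, Real.norm_of_nonneg h0.le,
        mul_one]
    rw [norm_Omega_eq_one_iff (by rwa [hn]) (by rwa [hn]), hn, Complex.re_ofReal_mul,
      Complex.exp_ofReal_mul_I_re, ← Real.cos_abs, hθ, Real.cos_arccos hF.1 hF.2]
  · intro h
    have h0 : 0 < ‖z‖ := by
      rw [norm_pos_iff]
      rintro rfl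
      simp [Omega] at h
    have hre := (norm_Omega_eq_one_iff h0 hz).1 h
    have habs := abs_le.1 (Complex.abs_re_le_norm z)
    have hcos : Real.cos (Complex.arg z) = F t ‖z‖ := by
      rw [Complex.cos_arg (norm_pos_iff.1 h0), hre, mul_div_cancel_left₀ _ h0.ne']
    refine ⟨‖z‖, (hI _).2 ⟨⟨h0, hz⟩, ?_⟩, Complex.arg z, ?_,
      (Complex.norm_mul_exp_arg_mul_I z).symm⟩
    · rw [← hcos]
      exact Real.cos_mem_Icc _
    · rw [← hcos, ← Real.cos_abs, Real.arccos_cos (abs_nonneg _) (Complex.abs_arg_le_pi z)]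

lemma mem_tildeGamma_iff {t : ℝ} (ht : 0 ≤ t) {z : ℂ} (hz : ‖z‖ < 1) :
    z ∈ tildeGamma t ↔ ‖Omega t z‖ = 1 := by
  obtain ⟨hmin, -⟩ := rMin_spec ht
  unfold tildeGamma
  split_ifs with h
  · rw [Set.mem_union, or_iff_left, mem_polarCurve_iff (fun r => ?_) hz]
    · constructor
      · rintro ⟨h1, h2⟩
        have h0 := hmin.1.trans_le h1
        exact ⟨⟨h0, h2⟩, (neg_one_le_F_iff h0 h2).2 (h.trans (one_lt_timeMax h0 h2).le),
          (F_le_one_iff h0 h2).2 ((timeMin_le_iff ht ⟨h0, h2.le⟩).2 h1)⟩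
      · rintro ⟨⟨h0, h1⟩, -, hF⟩
        exact ⟨(timeMin_le_iff ht ⟨h0, h1.le⟩).1 ((F_le_one_iff h0 h1).1 hF), h1⟩
    -- The two added endpoints lie on the unit circle and play no role inside the disk.
    · rintro (rfl | rfl)
      · rw [Complex.norm_exp_ofReal_mul_I] at hz
        exact lt_irrefl _ hz
      · rw [← neg_mul, ← Complex.ofReal_neg, Complex.norm_exp_ofReal_mul_I] at hz
        exact lt_irrefl _ hz
  · rw [not_le] at h
    obtain ⟨hmax, -⟩ := rMax_spec h
    refine mem_polarCurve_iff (fun r => ?_) hz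
    constructor
    · rintro ⟨h1, h2⟩
      have h0 := hmin.1.trans_le h1
      have h3 := h2.trans_lt hmax.2
      exact ⟨⟨h0, h3⟩, (neg_one_le_F_iff h0 h3).2 ((le_timeMax_iff h ⟨h0, h3⟩).2 h2),
        (F_le_one_iff h0 h3).2 ((timeMin_le_iff ht ⟨h0, h3.le⟩).2 h1)⟩
    · rintro ⟨⟨h0, h1⟩, hF', hF⟩
      exact ⟨(timeMin_le_iff ht ⟨h0, h1.le⟩).1 ((F_le_one_iff h0 h1).1 hF),
        (le_timeMax_iff h ⟨h0, h1⟩).1 ((neg_one_le_F_iff h0 h1).1 hF')⟩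

lemma connectedComponentIn_eq_subunitDomain {t : ℝ} (ht : 0 ≤ t)
    (hc : IsPreconnected (subunitDomain t)) :
    connectedComponentIn (Metric.ball (0 : ℂ) 1 \ tildeGamma t) 0 = subunitDomain t := by
  have hsub : subunitDomain t ⊆ Metric.ball (0 : ℂ) 1 \ tildeGamma t := fun z hz =>
    ⟨mem_ball_zero_iff.2 hz.1, fun h => hz.2.ne ((mem_tildeGamma_iff ht hz.1).1 h)⟩
  have h0 := zero_mem_subunitDomain t
  refine Set.Subset.antisymm ?_ (hc.subset_connectedComponentIn h0 hsub)
  have ho : IsOpen (Metric.ball (0 : ℂ) 1 ∩ Omega t ⁻¹' {w | 1 < ‖w‖}) :=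
    (continuousOn_Omega t).isOpen_inter_preimage Metric.isOpen_ball
      (isOpen_lt continuous_const continuous_norm)
  refine isPreconnected_connectedComponentIn.subset_left_of_subset_union
    (isOpen_subunitDomain t) ho ?_ ?_ ⟨0, mem_connectedComponentIn (hsub h0), h0⟩
  · exact Set.disjoint_left.2 fun z hz hz' => lt_asymm hz.2 hz'.2
  · intro z hz
    obtain ⟨hz1, hz2⟩ := connectedComponentIn_subset _ _ hz
    have hz3 := mem_ball_zero_iff.1 hz1
    rcases lt_trichotomy ‖Omega t z‖ 1 with h | h | h
    · exact Or.inl ⟨hz3, h⟩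
    · exact absurd ((mem_tildeGamma_iff ht hz3).2 h) hz2
    · exact Or.inr ⟨hz1, h⟩

end

end RadialSLE

theorem proposition4p7 (μ : ℝ → MeasureTheory.Measure Circle)
    (hμ : RadialSLE.IsHydrodynamicLimit μ) (t : ℝ) (ht : 0 ≤ t) :
    RadialSLE.tildeDomain μ t =
        connectedComponentIn (Metric.ball (0 : ℂ) 1 \ RadialSLE.tildeGamma t) 0 ∧
      (0 : ℂ) ∈ RadialSLE.tildeDomain μ t ∧
      RadialSLE.MapsConformallyOnto (RadialSLE.Omega t) (RadialSLE.tildeDomain μ t)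
        (Metric.ball (0 : ℂ) 1) ∧
      ∀ U : Set ℂ, (0 : ℂ) ∈ U →
        RadialSLE.MapsConformallyOnto (RadialSLE.Omega t) U (Metric.ball (0 : ℂ) 1) →
        U = RadialSLE.tildeDomain μ t := by
  have h0 := RadialSLE.zero_mem_subunitDomain t
  have hmap := RadialSLE.mapsConformallyOnto_subunitDomain hμ ht
  rw [RadialSLE.tildeDomain_eq_subunitDomain hμ ht,
    RadialSLE.connectedComponentIn_eq_subunitDomain ht
      (RadialSLE.isPreconnected_subunitDomain hμ ht)]
  -- `U` need not be assumed to avoid `1`: division by zero gives `Omega t 1 = 1`, outside the open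
  -- disk.
  exact ⟨rfl, h0, hmap, fun U hU hUmap =>
    hUmap.eq hmap (convex_ball (0 : ℂ) 1).isPreconnected ⟨0, hU, h0⟩⟩
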